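/- Let $\mathcal H=(C,F,D,G)$ be a hybrid system on $\mathbb R^n$ with flow set $C$, jump set $D$ and set-valued flow and jump maps $F,G:\mathbb R^n\rightrightarrows\mathbb R^n$. Assume that $C,D$ are closed, that $F$ is outer semicontinuous and locally bounded relative to $C$ with $F(x)$ convex for every $x\in C$, and that $G$ is outer semicontinuous and locally bounded relative to $D$. Let $\mathbb B$ be the closed unit ball, write $S+r\mathbb B=\{s+rb:s\in S,\ b\in\mathbb B\}$, and for $\delta\ge 0$ let $\mathcal H_\delta=(C_\delta,F_\delta,D_\delta,G_\delta)$ with $C_\delta=C+\delta\mathbb B$, $F_\delta(x)=F(x)+\delta\mathbb B$, $D_\delta=D+\delta\mathbb B$, $G_\delta(x)=G(x)+\delta\mathbb B$. A hybrid time domain is a nonempty $E\subseteq\mathbb R_{\ge0}\times\mathbb N$ such that for each $(T,K)\in E$ the set $E\cap([0,T]\times\{0,\dots,K\})$ has the form $\bigcup_{j=0}^{J}[t_j,t_{j+1}]\times\{j\}$ with $0=t_0\le t_1\le\dots\le t_{J+1}$. A hybrid arc is a map $\phi:\operatorname{dom}\phi\to\mathbb R^n$ on a hybrid time domain such that, for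 each $j$, $t\mapsto\phi(t,j)$ is locally absolutely continuous on $I^j=\{t:(t,j)\in\operatorname{dom}\phi\}$. It is a solution to $\mathcal H_\delta$ if $\phi(0,0)\in\overline{C_\delta}\cup D_\delta$; for each $j$ with $\operatorname{int}I^j\ne\emptyset$, $\phi(t,j)\in C_\delta$ for all $t\in\operatorname{int}I^j$ and $\dot\phi(t,j)\in F_\delta(\phi(t,j))$ for almost all $t\in I^j$; and $\phi(t,j)\in D_\delta$, $\phi(t,j+1)\in G_\delta(\phi(t,j))$ whenever $(t,j),(t,j+1)\in\operatorname{dom}\phi$. It is maximal if no solution extends it to a strictly larger domain. Its range is $\operatorname{rge}\phi=\{\phi(t,j):(t,j)\in\operatorname{dom}\phi\}$. A set $\mathfrak O$ is forward pre-invariant for $\mathcal H_\delta$ if $\operatorname{rge}\phi\subseteq\mathfrak O$ for every maximal solution $\phi$ with $\phi(0,0)\in\mathfrak O$. Let $A,\mathcal X_0\subseteq\mathbb R^n$ be compact, let $U\subseteq\mathbb R^n$ and $\delta\ge0$. Suppose there are an open set $\mathfrak O$, forward pre-invariant for $\mathcal H_\delta$, with $A\cup\mathcal X_0\subseteq\mathfrak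 O$ and $\mathfrak O\cap U=\emptyset$; a continuous $\omega:\mathfrak O\to\mathbb R_{\ge0}$ which is a proper indicator for $A$ on $\mathfrak O$ (that is, $\omega(x)=0$ iff $x\in A$, and $\omega(x_k)\to\infty$ for every sequence $(x_k)$ in $\mathfrak O$ with $x_k\to p\in\partial\mathfrak O$ or $|x_k|\to\infty$); a smooth function $V:\mathfrak O\to\mathbb R_{\ge0}$; and functions $\alpha_1,\alpha_2$ of class $\mathcal K_\infty$ (continuous, strictly increasing, unbounded maps $\mathbb R_{\ge0}\to\mathbb R_{\ge0}$ vanishing at $0$), such that $$\alpha_1(\omega(x))\le V(x)\le\alpha_2(\omega(x)),\qquad x\in\big(C_\delta\cup D_\delta\cup G_\delta(D_\delta)\big)\cap\mathfrak O,\quad G_\delta(D_\delta)=\bigcup_{z\in D_\delta}G_\delta(z),$$ $$\nabla V(x)\cdot f\le -V(x),\qquad x\in C_\delta\cap\mathfrak O,\ f\in F_\delta(x),$$ $$V(g)\le V(x)/e,\qquad x\in D_\delta\cap\mathfrak O,\ g\in G_\delta(x).$$ Then for every $\varepsilon>0$ the system $\mathcal H_\delta$ satisfies the reach-avoid-stay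 specification $(\mathcal X_0,U,A+\varepsilon\mathbb B)$: there is $T\ge0$ such that $\phi(t,j)\in A+\varepsilon\mathbb B$ for every maximal solution $\phi$ to $\mathcal H_\delta$ with $\phi(0,0)\in\mathcal X_0$ and every $(t,j)\in\operatorname{dom}\phi$ with $t+j\ge T$; and $\operatorname{rge}\phi\cap U=\emptyset$ for every such $\phi$. -/

import Mathlib

open scoped NNReal Pointwise ContDiff Topology

/-- The data `(C, F, D, G)` of a hybrid system on `ℝⁿ`: flow set, set-valued flow map, jump set,
set-valued jump map. -/
structure HybridSystem (n : ℕ) where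
  C : Set (EuclideanSpace ℝ (Fin n))
  F : EuclideanSpace ℝ (Fin n) → Set (EuclideanSpace ℝ (Fin n))
  D : Set (EuclideanSpace ℝ (Fin n))
  G : EuclideanSpace ℝ (Fin n) → Set (EuclideanSpace ℝ (Fin n))

/-- The `r`-neighbourhood `A + r𝔹`, with `𝔹` the closed unit ball. -/
def inflate {n : ℕ} (A : Set (EuclideanSpace ℝ (Fin n))) (r : ℝ) :
    Set (EuclideanSpace ℝ (Fin n)) :=
  A + Metric.closedBall 0 r

/-- The additive `δ`-perturbation `H_δ` of a hybrid system. -/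
def HybridSystem.perturb {n : ℕ} (H : HybridSystem n) (δ : ℝ) : HybridSystem n where
  C := inflate H.C δ
  F := fun x => inflate (H.F x) δ
  D := inflate H.D δ
  G := fun x => inflate (H.G x) δ

/-- Outer semicontinuity of a set-valued map relative to a set `S`. -/
def OuterSemicontinuousRel {n : ℕ}
    (M : EuclideanSpace ℝ (Fin n) → Set (EuclideanSpace ℝ (Fin n)))
    (S : Set (EuclideanSpace ℝ (Fin n))) : Prop :=
  ∀ x ∈ S, ∀ (u v : ℕ → EuclideanSpace ℝ (Fin n)) (y : EuclideanSpace ℝ (Fin n)),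
    (∀ i, u i ∈ S) → (∀ i, v i ∈ M (u i)) →
    Filter.Tendsto u Filter.atTop (𝓝 x) → Filter.Tendsto v Filter.atTop (𝓝 y) → y ∈ M x

/-- Local boundedness of a set-valued map relative to a set `S`. -/
def LocallyBoundedRel {n : ℕ}
    (M : EuclideanSpace ℝ (Fin n) → Set (EuclideanSpace ℝ (Fin n)))
    (S : Set (EuclideanSpace ℝ (Fin n))) : Prop :=
  ∀ x ∈ S, ∃ W ∈ 𝓝 x, Bornology.IsBounded (⋃ z ∈ W ∩ S, M z)

/-- The basic conditions on a hybrid system. -/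
structure HybridSystem.BasicConditions {n : ℕ} (H : HybridSystem n) : Prop where
  isClosed_C : IsClosed H.C
  isClosed_D : IsClosed H.D
  osc_F : OuterSemicontinuousRel H.F H.C
  locallyBounded_F : LocallyBoundedRel H.F H.C
  convex_F : ∀ x ∈ H.C, Convex ℝ (H.F x)
  osc_G : OuterSemicontinuousRel H.G H.D
  locallyBounded_G : LocallyBoundedRel H.G H.D

/-- A compact hybrid time domain `⋃_{j=0}^{J} [t_j, t_{j+1}] × {j}` with
`0 = t_0 ≤ t_1 ≤ ... ≤ t_{J+1}`. -/
def IsCompactHybridTimeDomain (E : Set (ℝ × ℕ)) : Prop :=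
  ∃ (J : ℕ) (t : ℕ → ℝ), t 0 = 0 ∧ Monotone t ∧
    E = {p | p.2 ≤ J ∧ t p.2 ≤ p.1 ∧ p.1 ≤ t (p.2 + 1)}

/-- A (nonempty) hybrid time domain: each truncation `E ∩ ([0,T] × {0,...,J})` with `(T,J) ∈ E` is
a compact hybrid time domain. Thus `E` is a finite or infinite union of sets
`[t_j, t_{j+1}] × {j}`, where a last interval may be half-open or unbounded on the right. -/
def IsHybridTimeDomain (E : Set (ℝ × ℕ)) : Prop :=
  E.Nonempty ∧ ∀ p ∈ E, IsCompactHybridTimeDomain {q ∈ E | q.1 ≤ p.1 ∧ q.2 ≤ p.2}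

/-- A hybrid arc; the values of `val` outside `dom` are irrelevant. -/
structure HybridArc (n : ℕ) where
  dom : Set (ℝ × ℕ)
  val : ℝ → ℕ → EuclideanSpace ℝ (Fin n)
  isHybridTimeDomain : IsHybridTimeDomain dom
  locallyAbsolutelyContinuous : ∀ (j : ℕ) (a b : ℝ), (a, j) ∈ dom → (b, j) ∈ dom → a ≤ b →
    AbsolutelyContinuousOnInterval (fun t => val t j) a b

namespace HybridArc

/-- The interval `I^j = {t : (t,j) ∈ dom φ}`. -/
def interval {n : ℕ} (φ : HybridArc n) (j : ℕ) : Set ℝ := {t | (t, j) ∈ φ.dom}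

/-- The range of a hybrid arc. -/
def rge {n : ℕ} (φ : HybridArc n) : Set (EuclideanSpace ℝ (Fin n)) :=
  {x | ∃ t j, (t, j) ∈ φ.dom ∧ φ.val t j = x}

/-- `φ` is a solution to the hybrid system `H`. -/
structure IsSolution {n : ℕ} (φ : HybridArc n) (H : HybridSystem n) : Prop where
  init : φ.val 0 0 ∈ closure H.C ∪ H.D
  flow_mem : ∀ j, (interior (φ.interval j)).Nonempty →
    ∀ t ∈ interior (φ.interval j), φ.val t j ∈ H.C
  flow : ∀ j, (interior (φ.interval j)).Nonempty →
    ∀ᵐ t ∂(MeasureTheory.volume.restrict (φ.interval j)),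
      ∃ v ∈ H.F (φ.val t j), HasDerivAt (fun s => φ.val s j) v t
  jump : ∀ t j, (t, j) ∈ φ.dom → (t, j + 1) ∈ φ.dom →
    φ.val t j ∈ H.D ∧ φ.val t (j + 1) ∈ H.G (φ.val t j)

/-- `φ` is a maximal solution to `H`: a solution that no solution extends to a strictly larger
domain. -/
def IsMaximalSolution {n : ℕ} (φ : HybridArc n) (H : HybridSystem n) : Prop :=
  φ.IsSolution H ∧ ¬ ∃ ψ : HybridArc n, ψ.IsSolution H ∧
    (∀ t j, (t, j) ∈ φ.dom → φ.val t j = ψ.val t j) ∧ φ.dom ⊂ ψ.dom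

end HybridArc

namespace HybridSystem

/-- The set of maximal solutions to `H` starting from `K`. -/
def maximalSolutions {n : ℕ} (H : HybridSystem n) (K : Set (EuclideanSpace ℝ (Fin n))) :
    Set (HybridArc n) :=
  {φ | φ.IsMaximalSolution H ∧ φ.val 0 0 ∈ K}

/-- The set of points reached from `K` at hybrid times `(t,j)` with `t + j ≥ T`. -/
def reachGE {n : ℕ} (H : HybridSystem n) (T : ℝ) (K : Set (EuclideanSpace ℝ (Fin n))) :
    Set (EuclideanSpace ℝ (Fin n)) :=
  {x | ∃ φ ∈ H.maximalSolutions K, ∃ t j, (t, j) ∈ φ.dom ∧ T ≤ t + (j : ℝ) ∧ φ.val t j = x}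

/-- Forward pre-invariance. -/
def ForwardPreInvariant {n : ℕ} (H : HybridSystem n) (K : Set (EuclideanSpace ℝ (Fin n))) : Prop :=
  ∀ φ ∈ H.maximalSolutions K, φ.rge ⊆ K

/-- The reach-avoid-stay specification `(X₀, U, I)`. -/
def ReachAvoidStay {n : ℕ} (H : HybridSystem n) (X₀ U I : Set (EuclideanSpace ℝ (Fin n))) : Prop :=
  (∃ T : ℝ, 0 ≤ T ∧ H.reachGE T X₀ ⊆ I) ∧ ∀ φ ∈ H.maximalSolutions X₀, φ.rge ∩ U = ∅

end HybridSystem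

/-- Class `𝒦∞`: continuous, zero at zero, strictly increasing, unbounded. -/
structure IsClassKInfty (α : ℝ≥0 → ℝ≥0) : Prop where
  continuous : Continuous α
  map_zero : α 0 = 0
  strictMono : StrictMono α
  unbounded : ¬ BddAbove (Set.range α)

/-- `w` (only its values on `O` matter) is a proper indicator for `A` on `O`. -/
structure IsProperIndicator {n : ℕ} (w : EuclideanSpace ℝ (Fin n) → ℝ≥0)
    (A O : Set (EuclideanSpace ℝ (Fin n))) : Prop where
  continuousOn : ContinuousOn w O
  eq_zero_iff : ∀ x ∈ O, w x = 0 ↔ x ∈ A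
  tendsto_atTop : ∀ u : ℕ → EuclideanSpace ℝ (Fin n), (∀ k, u k ∈ O) →
    ((∃ p ∈ frontier O, Filter.Tendsto u Filter.atTop (𝓝 p)) ∨
      Filter.Tendsto (fun k => ‖u k‖) Filter.atTop Filter.atTop) →
    Filter.Tendsto (fun k => w (u k)) Filter.atTop Filter.atTop

/-- The Lyapunov-barrier condition for a hybrid system `H`: there are an open forward pre-invariant
set `O` containing `A ∪ X₀` and disjoint from `U`, a proper indicator `w` for `A` on `O`, a smooth
`V : O → ℝ≥0` (only its values on `O` matter) and class `𝒦∞` functions `α₁`, `α₂` with the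
sandwich, flow-decrease and jump-decrease inequalities. -/
def HybridSystem.LyapunovBarrierCondition {n : ℕ} (H : HybridSystem n)
    (X₀ U A : Set (EuclideanSpace ℝ (Fin n))) : Prop :=
  ∃ (O : Set (EuclideanSpace ℝ (Fin n))) (w : EuclideanSpace ℝ (Fin n) → ℝ≥0)
    (V : EuclideanSpace ℝ (Fin n) → ℝ) (α₁ α₂ : ℝ≥0 → ℝ≥0),
    IsOpen O ∧ H.ForwardPreInvariant O ∧ A ∪ X₀ ⊆ O ∧ O ∩ U = ∅ ∧
    IsProperIndicator w A O ∧
    ContDiffOn ℝ ∞ V O ∧ (∀ x ∈ O, 0 ≤ V x) ∧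
    IsClassKInfty α₁ ∧ IsClassKInfty α₂ ∧
    (∀ x ∈ (H.C ∪ H.D ∪ ⋃ z ∈ H.D, H.G z) ∩ O,
      (α₁ (w x) : ℝ) ≤ V x ∧ V x ≤ (α₂ (w x) : ℝ)) ∧
    (∀ x ∈ H.C ∩ O, ∀ f ∈ H.F x, inner ℝ (gradient V x) f ≤ -V x) ∧
    (∀ x ∈ H.D ∩ O, ∀ g ∈ H.G x, V g ≤ V x / Real.exp 1)

open Set Filter MeasureTheory

theorem LocallyLipschitzOn.comp_absolutelyContinuousOnInterval {X Y : Type*}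
    [PseudoMetricSpace X] [PseudoMetricSpace Y] {f : ℝ → X} {g : X → Y} {a b : ℝ}
    (hg : LocallyLipschitzOn (f '' uIcc a b) g) (hfc : ContinuousOn f (uIcc a b))
    (hf : AbsolutelyContinuousOnInterval f a b) :
    AbsolutelyContinuousOnInterval (fun t => g (f t)) a b := by
  obtain ⟨K, hK⟩ := hg.exists_lipschitzOnWith_of_compact (isCompact_uIcc.image_of_continuousOn hfc)
  rw [absolutelyContinuousOnInterval_iff] at hf ⊢
  intro ε hε
  obtain ⟨η, hη, h⟩ := hf (ε / (K + 1)) (by positivity)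
  refine ⟨η, hη, fun E hE hlt => ?_⟩
  have hE' := h E hE hlt
  calc
    _ ≤ ∑ i ∈ Finset.range E.1, K * dist (f (E.2 i).1) (f (E.2 i).2) :=
        Finset.sum_le_sum fun i hi => hK.dist_le_mul _ (mem_image_of_mem f (hE.1 i hi).1) _
          (mem_image_of_mem f (hE.1 i hi).2)
    _ = K * ∑ i ∈ Finset.range E.1, dist (f (E.2 i).1) (f (E.2 i).2) := by rw [Finset.mul_sum]
    _ ≤ K * (ε / (K + 1)) := by gcongr
    _ < ε := by
        rw [mul_div_assoc', div_lt_iff₀ (by positivity)]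
        nlinarith [K.coe_nonneg]

theorem AbsolutelyContinuousOnInterval.le_of_ae_hasDerivAt_nonpos {f : ℝ → ℝ} {a b : ℝ}
    (hf : AbsolutelyContinuousOnInterval f a b) (hab : a ≤ b)
    (h : ∀ᵐ t, t ∈ Ioo a b → ∃ d ≤ 0, HasDerivAt f d t) : f b ≤ f a := by
  have hint : ∫ t in a..b, deriv f t ≤ 0 := by
    rw [intervalIntegral.integral_of_le hab, integral_Ioc_eq_integral_Ioo]
    refine integral_nonpos_of_ae ?_
    rw [EventuallyLE, ae_restrict_iff' measurableSet_Ioo]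
    filter_upwards [h] with t ht hmem
    obtain ⟨d, hd, hdt⟩ := ht hmem
    simpa [hdt.deriv] using hd
  linarith [hf.integral_deriv_eq_sub]

theorem inflate_isClosed {n : ℕ} {A : Set (EuclideanSpace ℝ (Fin n))} (hA : IsClosed A) (r : ℝ) :
    IsClosed (inflate A r) :=
  hA.add_right_of_isCompact (isCompact_closedBall 0 r)

theorem mem_inflate_of_dist_le {n : ℕ} {A : Set (EuclideanSpace ℝ (Fin n))} {r : ℝ}
    {x a : EuclideanSpace ℝ (Fin n)} (ha : a ∈ A) (h : dist x a ≤ r) : x ∈ inflate A r :=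
  ⟨a, ha, x - a, by simpa [dist_eq_norm] using h, by simp⟩

theorem IsHybridTimeDomain.exists_times {E : Set (ℝ × ℕ)} (hE : IsHybridTimeDomain E) {T : ℝ}
    {J : ℕ} (h : (T, J) ∈ E) :
    ∃ t : ℕ → ℝ, t 0 = 0 ∧ Monotone t ∧ T ∈ Icc (t J) (t (J + 1)) ∧
      ∀ j ≤ J, ∀ s ∈ Icc (t j) (t (j + 1)), (s, j) ∈ E := by
  obtain ⟨J', t, ht0, htm, heq⟩ := hE.2 _ h
  have hT : (T, J) ∈ {p : ℝ × ℕ | p.2 ≤ J' ∧ t p.2 ≤ p.1 ∧ p.1 ≤ t (p.2 + 1)} :=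
    heq ▸ (⟨h, le_rfl, le_rfl⟩ : (T, J) ∈ {q ∈ E | q.1 ≤ T ∧ q.2 ≤ J})
  refine ⟨t, ht0, htm, hT.2, fun j hj s hs => ?_⟩
  have : (s, j) ∈ {p : ℝ × ℕ | p.2 ≤ J' ∧ t p.2 ≤ p.1 ∧ p.1 ≤ t (p.2 + 1)} :=
    ⟨hj.trans hT.1, hs⟩
  rw [← heq] at this
  exact this.1

/-- Sublevel sets of a proper indicator at small levels lie in any neighbourhood `A + ε𝔹`. -/
theorem IsProperIndicator.exists_pos_forall_mem_inflate {n : ℕ}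
    {w : EuclideanSpace ℝ (Fin n) → ℝ≥0} {A O : Set (EuclideanSpace ℝ (Fin n))}
    (hw : IsProperIndicator w A O) (hO : IsOpen O) {ε : ℝ} (hε : 0 < ε) :
    ∃ c : ℝ≥0, 0 < c ∧ ∀ x ∈ O, w x < c → x ∈ inflate A ε := by
  by_contra! hcon
  choose u huO huw huA using fun k : ℕ => hcon (1 / ((k : ℝ≥0) + 1)) (by positivity)
  have hw0 : Tendsto (fun k => w (u k)) atTop (𝓝 0) :=
    tendsto_of_tendsto_of_tendsto_of_le_of_le tendsto_const_nhds
      tendsto_one_div_add_atTop_nhds_zero_nat (fun _ => zero_le) fun k => (huw k).le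
  have hsub : ∀ ψ : ℕ → ℕ, StrictMono ψ →
      ¬ Tendsto (fun k => w (u (ψ k))) atTop atTop := fun ψ hψ h =>
    not_tendsto_nhds_of_tendsto_atTop h 0 (hw0.comp hψ.tendsto_atTop)
  by_cases hunb : ∀ R : ℝ, ∃ᶠ k in atTop, R < ‖u k‖
  · obtain ⟨ψ, hψ, hψR⟩ := extraction_forall_of_frequently fun k : ℕ => hunb k
    exact hsub ψ hψ (hw.tendsto_atTop (u ∘ ψ) (fun k => huO _) (Or.inr
      (tendsto_atTop_mono (fun k => (hψR k).le) tendsto_natCast_atTop_atTop)))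
  · push Not at hunb
    obtain ⟨R, hR⟩ := hunb
    obtain ⟨p, -, ψ, hψ, hp⟩ := tendsto_subseq_of_frequently_bounded
      (Metric.isBounded_closedBall (x := (0 : EuclideanSpace ℝ (Fin n))) (r := R))
      (x := u) (by simpa using hR.frequently)
    have hpc : p ∈ closure O := mem_closure_of_tendsto hp (Eventually.of_forall fun k => huO _)
    by_cases hpO : p ∈ O
    · have hwp : Tendsto (fun k => w (u (ψ k))) atTop (𝓝 (w p)) :=
        ((hw.continuousOn.continuousAt (hO.mem_nhds hpO)).tendsto).comp hp
      have hpA : p ∈ A := (hw.eq_zero_iff p hpO).1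
        (tendsto_nhds_unique hwp (hw0.comp hψ.tendsto_atTop))
      obtain ⟨k, hk⟩ := (hp.eventually (Metric.closedBall_mem_nhds p hε)).exists
      exact huA _ (mem_inflate_of_dist_le hpA hk)
    · exact hsub ψ hψ (hw.tendsto_atTop (u ∘ ψ) (fun k => huO _) (Or.inl
        ⟨p, by rw [hO.frontier_eq]; exact ⟨hpc, hpO⟩, hp⟩))

namespace HybridArc

variable {n : ℕ} {φ : HybridArc n} {H : HybridSystem n} {j : ℕ} {a b : ℝ}

theorem Ioo_subset_interior_interval (hdom : ∀ s ∈ Icc a b, (s, j) ∈ φ.dom) :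
    Ioo a b ⊆ interior (φ.interval j) :=
  interior_maximal (fun s hs => hdom s (Ioo_subset_Icc_self hs)) isOpen_Ioo

theorem absolutelyContinuousOnInterval (hab : a ≤ b) (hdom : ∀ s ∈ Icc a b, (s, j) ∈ φ.dom) :
    AbsolutelyContinuousOnInterval (fun t => φ.val t j) a b :=
  φ.locallyAbsolutelyContinuous j a b (hdom a ⟨le_rfl, hab⟩) (hdom b ⟨hab, le_rfl⟩) hab

namespace IsSolution

theorem mem_flowSet_of_mem_Icc (hφ : φ.IsSolution H) (hC : IsClosed H.C) (hab : a < b)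
    (hdom : ∀ s ∈ Icc a b, (s, j) ∈ φ.dom) {s : ℝ} (hs : s ∈ Icc a b) : φ.val s j ∈ H.C := by
  have hcont := (φ.absolutelyContinuousOnInterval hab.le hdom).continuousOn
  rw [uIcc_of_le hab.le, ← closure_Ioo hab.ne] at hcont
  have hint := Ioo_subset_interior_interval hdom
  have hmaps : MapsTo (fun t => φ.val t j) (Ioo a b) H.C := fun t ht =>
    hφ.flow_mem j ⟨t, hint ht⟩ t (hint ht)
  have := hmaps.closure_of_continuousOn hcont
  rw [closure_Ioo hab.ne, hC.closure_eq] at this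
  exact this hs

/-- Along a flow, a function with `∇V(x) · f ≤ -V(x)` decays at unit exponential rate. -/
theorem exp_mul_le_of_flow (hφ : φ.IsSolution H) {O : Set (EuclideanSpace ℝ (Fin n))}
    (hO : IsOpen O) (hrge : φ.rge ⊆ O) {V : EuclideanSpace ℝ (Fin n) → ℝ}
    (hV : ContDiffOn ℝ ∞ V O)
    (hdec : ∀ x ∈ H.C ∩ O, ∀ f ∈ H.F x, inner ℝ (gradient V x) f ≤ -V x)
    (hab : a ≤ b) (hdom : ∀ s ∈ Icc a b, (s, j) ∈ φ.dom) :
    Real.exp b * V (φ.val b j) ≤ Real.exp a * V (φ.val a j) := by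
  have hac := φ.absolutelyContinuousOnInterval hab hdom
  have hmem : ∀ s ∈ Icc a b, φ.val s j ∈ O := fun s hs => hrge ⟨s, j, hdom s hs, rfl⟩
  have hloc : LocallyLipschitzOn ((fun t => φ.val t j) '' uIcc a b) V := by
    rintro _ ⟨s, hs, rfl⟩
    rw [uIcc_of_le hab] at hs
    obtain ⟨K, t, ht, hK⟩ := ((hV.contDiffAt (hO.mem_nhds (hmem s hs))).of_le
      (by exact_mod_cast le_top : (1 : WithTop ℕ∞) ≤ ∞)).exists_lipschitzOnWith
    exact ⟨K, t, mem_nhdsWithin_of_mem_nhds ht, hK⟩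
  have hexp : AbsolutelyContinuousOnInterval Real.exp a b :=
    Real.contDiff_exp.contDiffOn.absolutelyContinuousOnInterval
  refine (hexp.fun_mul (hloc.comp_absolutelyContinuousOnInterval
    hac.continuousOn hac)).le_of_ae_hasDerivAt_nonpos hab ?_
  have hint := Ioo_subset_interior_interval hdom
  rcases (Ioo a b).eq_empty_or_nonempty with hemp | ⟨m, hm⟩
  · simp [hemp]
  have hflow := ae_restrict_of_ae_restrict_of_subset (hint.trans interior_subset)
    (hφ.flow j ⟨m, hint hm⟩)
  rw [ae_restrict_iff' measurableSet_Ioo] at hflow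
  filter_upwards [hflow] with t ht hmt
  obtain ⟨v, hv, hd⟩ := ht hmt
  have htO := hmem t (Ioo_subset_Icc_self hmt)
  have hVd : DifferentiableAt ℝ V (φ.val t j) :=
    (hV.contDiffAt (hO.mem_nhds htO)).differentiableAt (by simp)
  have hcomp : HasDerivAt (fun s => V (φ.val s j)) (inner ℝ (gradient V (φ.val t j)) v) t := by
    exact hVd.hasGradientAt.hasFDerivAt.comp_hasDerivAt t hd
  refine ⟨_, ?_, (Real.hasDerivAt_exp t).mul hcomp⟩
  have := hdec _ ⟨hφ.flow_mem j ⟨m, hint hm⟩ t (hint hmt), htO⟩ v hv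
  nlinarith [Real.exp_pos t]

/-- Combined decay of `V` in hybrid time `t + j`. -/
theorem exp_mul_le (hφ : φ.IsSolution H) {O : Set (EuclideanSpace ℝ (Fin n))}
    (hO : IsOpen O) (hrge : φ.rge ⊆ O) {V : EuclideanSpace ℝ (Fin n) → ℝ}
    (hV : ContDiffOn ℝ ∞ V O)
    (hdec : ∀ x ∈ H.C ∩ O, ∀ f ∈ H.F x, inner ℝ (gradient V x) f ≤ -V x)
    (hjump : ∀ x ∈ H.D ∩ O, ∀ g ∈ H.G x, V g ≤ V x / Real.exp 1)
    {T : ℝ} {J : ℕ} (hT : (T, J) ∈ φ.dom) :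
    Real.exp (T + J) * V (φ.val T J) ≤ V (φ.val 0 0) := by
  obtain ⟨t, ht0, htm, hTJ, hdom⟩ := φ.isHybridTimeDomain.exists_times hT
  suffices h : ∀ j ≤ J, ∀ s ∈ Icc (t j) (t (j + 1)),
      Real.exp (s + j) * V (φ.val s j) ≤ V (φ.val 0 0) from h J le_rfl T hTJ
  have hstep : ∀ j ≤ J, ∀ s ∈ Icc (t j) (t (j + 1)),
      Real.exp (s + j) * V (φ.val s j) ≤ Real.exp (t j + j) * V (φ.val (t j) j) := by
    intro j hj s hs
    have := hφ.exp_mul_le_of_flow hO hrge hV hdec hs.1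
      fun r hr => hdom j hj r ⟨hr.1, hr.2.trans hs.2⟩
    rw [Real.exp_add, Real.exp_add, mul_right_comm, mul_right_comm (Real.exp (t j))]
    gcongr
  intro j
  induction j with
  | zero =>
    intro hj s hs
    simpa [ht0] using hstep 0 hj s hs
  | succ j ih =>
    intro hj s hs
    refine (hstep _ hj s hs).trans (le_trans ?_
      (ih (by omega) (t (j + 1)) ⟨htm (by omega), le_rfl⟩))
    have hpre := hdom j (by omega) (t (j + 1)) ⟨htm (by omega), le_rfl⟩
    obtain ⟨hD, hG⟩ := hφ.jump _ _ hpre (hdom (j + 1) hj _ ⟨le_rfl, htm (by omega)⟩)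
    have := hjump _ ⟨hD, hrge ⟨_, _, hpre, rfl⟩⟩ _ hG
    rw [le_div_iff₀ (Real.exp_pos 1)] at this
    push_cast
    rw [← add_assoc, Real.exp_add _ 1, mul_assoc, mul_comm (Real.exp 1)]
    gcongr

theorem val_mem (hφ : φ.IsSolution H) (hC : IsClosed H.C) {T : ℝ} {J : ℕ}
    (hT : (T, J) ∈ φ.dom) : φ.val T J ∈ H.C ∪ H.D ∪ ⋃ z ∈ H.D, H.G z := by
  obtain ⟨t, ht0, htm, hTJ, hdom⟩ := φ.isHybridTimeDomain.exists_times hT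
  rcases (htm J.le_succ).lt_or_eq with hlt | heq
  · exact Or.inl (Or.inl (hφ.mem_flowSet_of_mem_Icc hC hlt (hdom J le_rfl) hTJ))
  · have hTt : T = t J := le_antisymm (heq ▸ hTJ.2) hTJ.1
    rcases J with _ | J
    · have := hφ.init
      rw [hC.closure_eq] at this
      rw [hTt, ht0]
      exact Or.inl this
    · obtain ⟨hD, hG⟩ := hφ.jump T J
        (hTt ▸ hdom J (by omega) (t (J + 1)) ⟨htm (by omega), le_rfl⟩) hT
      exact Or.inr (mem_biUnion hD hG)

end IsSolution

end HybridArc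

theorem mainTheorem8 (n : ℕ) (H : HybridSystem n) (hH : H.BasicConditions)
    (δ : ℝ) (hδ : 0 ≤ δ) (X₀ U A : Set (EuclideanSpace ℝ (Fin n)))
    (hA : IsCompact A) (hX₀ : IsCompact X₀)
    (hV : (H.perturb δ).LyapunovBarrierCondition X₀ U A) (ε : ℝ) (hε : 0 < ε) :
    (H.perturb δ).ReachAvoidStay X₀ U (inflate A ε) := by
  obtain ⟨O, w, V, α₁, α₂, hO, hinv, hsub, hOU, hw, hVs, -, hα₁, -, hsand, hdec, hjump⟩ := hV
  have hX₀O : X₀ ⊆ O := subset_union_right.trans hsub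
  have hrge : ∀ φ ∈ (H.perturb δ).maximalSolutions X₀, φ.rge ⊆ O := fun φ hφ =>
    hinv φ ⟨hφ.1, hX₀O hφ.2⟩
  refine ⟨?_, fun φ hφ => subset_empty_iff.1 ((inter_subset_inter_left U (hrge φ hφ)).trans hOU.le)⟩
  obtain ⟨c, hc, hcA⟩ := hw.exists_pos_forall_mem_inflate hO hε
  obtain ⟨M, hM⟩ := hX₀.exists_bound_of_continuousOn (hVs.continuousOn.mono hX₀O)
  have hαc : (0 : ℝ) < α₁ c := by
    have := hα₁.strictMono hc
    rw [hα₁.map_zero] at this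
    exact_mod_cast this
  obtain ⟨T, hT⟩ := ((Real.tendsto_exp_atTop.eventually_gt_atTop (M / α₁ c)).and
    (eventually_ge_atTop 0)).exists
  refine ⟨T, hT.2, ?_⟩
  rintro _ ⟨φ, hφ, t, j, htj, hle, rfl⟩
  have hxO : φ.val t j ∈ O := hrge φ hφ ⟨t, j, htj, rfl⟩
  have hsol := hφ.1.1
  have hdecay := hsol.exp_mul_le hO (hrge φ hφ) hVs hdec hjump htj
  have hlow := (hsand _ ⟨hsol.val_mem (inflate_isClosed hH.isClosed_C δ) htj, hxO⟩).1
  refine hcA _ hxO (hα₁.strictMono.lt_iff_lt.1 ?_)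
  have hMT : M < Real.exp T * α₁ c := (div_lt_iff₀ hαc).1 hT.1
  have hV0 : V (φ.val 0 0) ≤ M := (le_abs_self _).trans (hM _ hφ.2)
  have hexp : Real.exp T ≤ Real.exp (t + j) := Real.exp_le_exp.2 hle
  have hlt : Real.exp (t + j) * α₁ (w (φ.val t j)) < Real.exp (t + j) * α₁ c := by
    calc _ ≤ Real.exp (t + j) * V (φ.val t j) := by gcongr
      _ < Real.exp T * α₁ c := by linarith
      _ ≤ _ := by gcongr
  exact_mod_cast lt_of_mul_lt_mul_left hlt (Real.exp_pos _).le
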